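/- Let $M$ be a compact Hausdorff smooth manifold without boundary of dimension $d$ (not necessarily connected). For a $C^2$ Riemannian metric $g$ on $M$, let $d_g(x,y)\in[0,\infty]$ be its geodesic distance, i.e. the infimum of the $g$-lengths of $C^1$ paths from $x$ to $y$ (so $d_g(x,y)=\infty$ if $x$ and $y$ lie in different components), and let $\mu_g$ be its Riemannian volume measure. Fix $t>0$ and a continuous function $p:M\to\mathbb{R}$ with $p(x)>0$ for all $x\in M$. For $f\in C(M)$, the space of continuous real-valued functions on $M$, define \[ (L^{(g)}_{t,p}f)(x):=\frac{1}{t^{d/2+1}}\int_M \exp\!\Big(-\frac{d_g(x,y)^2}{t}\Big)\,\bigl(f(x)-f(y)\bigr)\,p(y)\,d\mu_g(y),\qquad x\in M, \] with the convention $\exp(-\infty)=0$. If $g_1,g_2$ are $C^2$ Riemannian metrics on $M$ such that $L^{(g_1)}_{t,p}f=L^{(g_2)}_{t,p}f$ for every $f\in C(M)$, then $g_1=g_2$. -/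

import Mathlib

open scoped Manifold ContDiff Bundle

/-- A `C^2` Riemannian metric on a smooth manifold `M` modelled on `ℝ^d`: a `C^2` field of
symmetric positive definite bilinear forms on the tangent spaces. -/
abbrev C2Metric (d : ℕ) (M : Type*) [TopologicalSpace M]
    [ChartedSpace (EuclideanSpace ℝ (Fin d)) M] [IsManifold (𝓡 d) ∞ M] :=
  Bundle.ContMDiffRiemannianMetric (𝓡 d) 2 (EuclideanSpace ℝ (Fin d))
    (fun x : M => TangentSpace (𝓡 d) x)

namespace C2Metric

variable {d : ℕ} {M : Type*} [TopologicalSpace M]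
  [ChartedSpace (EuclideanSpace ℝ (Fin d)) M] [IsManifold (𝓡 d) ∞ M]

/-- The geodesic distance `d_g(x, y)`: the infimum of the `g`-lengths of the `C^1` paths from `x`
to `y`. It is `∞` exactly when `x` and `y` lie in different components. -/
noncomputable def geodesicEDist (g : C2Metric d M) (x y : M) : ENNReal :=
  letI : Bundle.RiemannianBundle (fun x : M => TangentSpace (𝓡 d) x) := ⟨g.toRiemannianMetric⟩
  Manifold.riemannianEDist (𝓡 d) x y

open Classical in
/-- The Gaussian kernel `exp (-d_g(x, y)^2 / t)`, with `exp (-∞) = 0`. -/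
noncomputable def gaussianKernel (g : C2Metric d M) (t : ℝ) (x y : M) : ℝ :=
  if g.geodesicEDist x y = ⊤ then 0 else Real.exp (-(g.geodesicEDist x y).toReal ^ 2 / t)

/-- The matrix `(g_{ij}(u))` of `g` in the coordinates of the chart at `x`, at the coordinate
point `u`: `g_{ij} = g(∂_i, ∂_j)`. -/
noncomputable def coordMatrix (g : C2Metric d M) (x : M) (u : EuclideanSpace ℝ (Fin d)) :
    Matrix (Fin d) (Fin d) ℝ :=
  let φ := chartAt (EuclideanSpace ℝ (Fin d)) x
  Matrix.of fun i j => g.inner (φ.symm u)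
    (mfderiv (𝓡 d) (𝓡 d) φ.symm u (EuclideanSpace.single i (1 : ℝ)))
    (mfderiv (𝓡 d) (𝓡 d) φ.symm u (EuclideanSpace.single j (1 : ℝ)))

/-- The Riemannian volume on the domain of the chart at `x`, that is
`√(det (g_{ij}(u))) du` transported to `M` (and `0` outside the domain of the chart). -/
noncomputable def chartVolume [MeasurableSpace M] (g : C2Metric d M) (x : M) :
    MeasureTheory.Measure M :=
  let φ := chartAt (EuclideanSpace ℝ (Fin d)) x
  ((MeasureTheory.volume.restrict φ.target).withDensity
    (fun u => ENNReal.ofReal (Real.sqrt (g.coordMatrix x u).det))).map φ.symm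

/-- The Riemannian volume measure `μ_g`. The measures `chartVolume g x` agree on overlaps of
charts, and their supremum (the least measure above all of them) is the measure whose restriction
to the domain of each chart is the Riemannian volume in that chart. -/
noncomputable def volumeMeasure [MeasurableSpace M] (g : C2Metric d M) :
    MeasureTheory.Measure M :=
  ⨆ x : M, g.chartVolume x

/-- The unnormalized continuous intrinsic graph Laplace operator
`(L f)(x) = t^{-(d/2+1)} ∫ exp (-d_g(x, y)^2 / t) (f x - f y) p(y) dμ_g(y)`. -/
noncomputable def graphLaplacian [MeasurableSpace M] (g : C2Metric d M) (t : ℝ) (p f : C(M, ℝ))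
    (x : M) : ℝ :=
  1 / t ^ ((d : ℝ) / 2 + 1) *
    ∫ y, g.gaussianKernel t x y * (f x - f y) * p y ∂g.volumeMeasure

end C2Metric

/-!
The operator at a point `x` determines the kernel times the volume, the volume is then separated
from the kernel on the diagonal, and the kernel determines the distance, hence the metric.

Applied to functions `f` with `f x = 0`, equality of the operators says that
`∫ K₁(x, y) f(y) p(y) dμ₁(y) = ∫ K₂(x, y) f(y) p(y) dμ₂(y)`, where `Kᵢ` is the Gaussian kernel and
`μᵢ` the volume of `gᵢ`. Taking `f` supported in the domain of one chart, with `ρᵢ` the volume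
densities `√det gᵢ` in this chart, yields `K₁(x, y) ρ₁(y) = K₂(x, y) ρ₂(y)` for all `y` in the chart
(`C2Metric.chartDensity_mul_gaussianKernel_eq`). For `y = x` the kernels are `1`, so `ρ₁ = ρ₂`
everywhere; dividing by the densities, the kernels agree, and so do the distances of points lying in
a common chart. That the Riemannian volume is `ρᵢ du` in each chart
(`C2Metric.volumeMeasure_restrict_source`) rests on the change of variables formula.

Finally the distance determines the metric (`C2Metric.inner_eq_of_geodesicEDist_eq`): the distance
from `x` to the point with coordinates `φ x + s v` is `s |v| + o(s)`. The upper bound is the length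
of a coordinate segment; for the lower bound, the coordinate function `g_x(v, ·)` has differential
of norm close to `|v|` near `x`, so that it grows by at most about `|v|` times the length along any
short path.
-/

section

open Set Filter MeasureTheory Manifold
open scoped Topology ENNReal NNReal

/-! ### Sharp local bounds for the Riemannian distance -/

section LocalDistance

variable {d : ℕ} {M : Type*} [TopologicalSpace M]
  [ChartedSpace (EuclideanSpace ℝ (Fin d)) M] [IsManifold (𝓡 d) ∞ M]
  [Bundle.RiemannianBundle (fun x : M => TangentSpace (𝓡 d) x)]

/-- Upper bound for the distance along a coordinate segment: if the coordinate vector field `v` has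
norm at most `C` near `x`, the segment from `x` in direction `v` run up to parameter `s` has length
at most `s * C`. The pointwise bound enters with its exact constant, so that `C` can be taken
arbitrarily close to the norm of `v` at `x`. -/
lemma eventually_riemannianEDist_le_mul (x : M) (v : EuclideanSpace ℝ (Fin d)) (C : ℝ≥0)
    (hC : ∀ᶠ u in 𝓝 (extChartAt (𝓡 d) x x),
      ‖(mfderivWithin 𝓘(ℝ, EuclideanSpace ℝ (Fin d)) (𝓡 d) (extChartAt (𝓡 d) x).symm
        (range (𝓡 d)) u v : TangentSpace (𝓡 d) ((extChartAt (𝓡 d) x).symm u))‖ₑ ≤ C) :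
    ∀ᶠ s : ℝ in 𝓝[>] 0, riemannianEDist (𝓡 d) x
      ((extChartAt (𝓡 d) x).symm (extChartAt (𝓡 d) x x + s • v)) ≤ ENNReal.ofReal s * C := by
  have hT : (extChartAt (𝓡 d) x).target ∈ 𝓝 (extChartAt (𝓡 d) x x) :=
    extChartAt_target_mem_nhds x
  obtain ⟨r, r_pos, hr⟩ := Metric.mem_nhds_iff.1 (inter_mem hT hC)
  have hcont : Tendsto (fun s : ℝ => extChartAt (𝓡 d) x x + s • v) (𝓝 0)
      (𝓝 (extChartAt (𝓡 d) x x)) := by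
    have : Continuous (fun s : ℝ => extChartAt (𝓡 d) x x + s • v) := by fun_prop
    simpa using this.tendsto 0
  filter_upwards [nhdsWithin_le_nhds (hcont (Metric.ball_mem_nhds _ r_pos)), self_mem_nhdsWithin]
    with s hs s_pos
  have s_pos : 0 < s := s_pos
  let η : ℝ → EuclideanSpace ℝ (Fin d) := fun τ => extChartAt (𝓡 d) x x + τ • v
  have hη : ∀ τ ∈ Icc 0 s, η τ ∈ Metric.ball (extChartAt (𝓡 d) x x) r := by
    intro τ hτ
    simp only [mem_preimage, Metric.mem_ball, dist_self_add_left, norm_smul, Real.norm_eq_abs,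
      abs_of_pos s_pos] at hs
    simp only [η, Metric.mem_ball, dist_self_add_left, norm_smul, Real.norm_eq_abs,
      abs_of_nonneg hτ.1]
    exact (mul_le_mul_of_nonneg_right hτ.2 (norm_nonneg _)).trans_lt hs
  have η_smooth : ContMDiffOn 𝓘(ℝ, ℝ) 𝓘(ℝ, EuclideanSpace ℝ (Fin d)) 1 η (Icc 0 s) := by
    rw [contMDiffOn_iff_contDiffOn]
    exact (contDiff_const.add (contDiff_id.smul contDiff_const)).contDiffOn
  have hηT : Icc 0 s ⊆ η ⁻¹' (extChartAt (𝓡 d) x).target := fun τ hτ => (hr (hη τ hτ)).1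
  have h1 : riemannianEDist (𝓡 d) x ((extChartAt (𝓡 d) x).symm (η s))
      ≤ pathELength (𝓡 d) ((extChartAt (𝓡 d) x).symm ∘ η) 0 s := by
    apply riemannianEDist_le_pathELength _ _ rfl s_pos.le
    · exact (contMDiffOn_extChartAt_symm x).comp η_smooth hηT
    · simp [η]
  refine h1.trans ?_
  rw [pathELength_eq_lintegral_mfderivWithin_Icc]
  calc _ ≤ ∫⁻ τ in Icc 0 s, (C : ℝ≥0∞) := by
        apply setLIntegral_mono' measurableSet_Icc (fun τ hτ ↦ ?_)
        have u : UniqueDiffWithinAt ℝ (Icc (0 : ℝ) s) τ := uniqueDiffOn_Icc s_pos τ hτ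
        have h2 : mfderivWithin 𝓘(ℝ, ℝ) (𝓡 d) ((extChartAt (𝓡 d) x).symm ∘ η) (Icc 0 s) τ =
            (mfderivWithin 𝓘(ℝ, EuclideanSpace ℝ (Fin d)) (𝓡 d) (extChartAt (𝓡 d) x).symm
              (range (𝓡 d)) (η τ)) ∘L
            (mfderivWithin 𝓘(ℝ, ℝ) 𝓘(ℝ, EuclideanSpace ℝ (Fin d)) η (Icc 0 s) τ) := by
          apply mfderivWithin_comp
          · exact mdifferentiableWithinAt_extChartAt_symm (hηT hτ)
          · exact η_smooth.mdifferentiableOn one_ne_zero τ hτ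
          · exact hηT.trans (preimage_mono (extChartAt_target_subset_range x))
          · exact u.uniqueMDiffWithinAt
        have h3 : mfderivWithin 𝓘(ℝ, ℝ) 𝓘(ℝ, EuclideanSpace ℝ (Fin d)) η (Icc 0 s) τ 1 = v := by
          rw [mfderivWithin_eq_fderivWithin]
          have : HasDerivWithinAt η ((1 : ℝ) • v) (Icc 0 s) τ :=
            (((hasDerivAt_id τ).smul_const v).const_add _).hasDerivWithinAt
          have h4 := this.hasFDerivWithinAt.fderivWithin u
          rw [h4]
          change (1 : ℝ) • ((1 : ℝ) • v) = v
          rw [one_smul, one_smul]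
        have h5 : mfderivWithin 𝓘(ℝ, ℝ) (𝓡 d) ((extChartAt (𝓡 d) x).symm ∘ η) (Icc 0 s) τ 1 =
            (mfderivWithin 𝓘(ℝ, EuclideanSpace ℝ (Fin d)) (𝓡 d) (extChartAt (𝓡 d) x).symm
              (range (𝓡 d)) (η τ)) v := by
          rw [h2]; exact congrArg _ h3
        rw [h5]
        exact (hr (hη τ hτ)).2
    _ = ENNReal.ofReal s * C := by
        rw [setLIntegral_const, Real.volume_Icc, sub_zero, mul_comm]

variable [IsContinuousRiemannianBundle (EuclideanSpace ℝ (Fin d))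
  (fun x : M => TangentSpace (𝓡 d) x)]

/-- Lower bound for the distance: if the differential of the coordinate function `l` has norm at
most `C` near `x`, then `l` is `C`-Lipschitz from `x` near `x`. Short paths from `x` cannot leave
the region where the bound on the differential holds, because distance balls around `x` are small
for the topology. -/
lemma eventually_enorm_clm_sub_le_riemannianEDist [RegularSpace M] (x : M)
    (l : EuclideanSpace ℝ (Fin d) →L[ℝ] ℝ) (C : ℝ≥0)
    (hC : ∀ᶠ y in 𝓝 x, ∀ w : TangentSpace (𝓡 d) y,
      ‖l (mfderiv (𝓡 d) 𝓘(ℝ, EuclideanSpace ℝ (Fin d)) (extChartAt (𝓡 d) x) y w)‖ₑ ≤ C * ‖w‖ₑ) :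
    ∀ᶠ y in 𝓝 x, ‖l (extChartAt (𝓡 d) x y - extChartAt (𝓡 d) x x)‖ₑ
      ≤ C * riemannianEDist (𝓡 d) x y := by
  obtain ⟨c, c_pos, hc⟩ := setOfPred_riemannianEDist_lt_subset_nhds' (𝓡 d)
    (inter_mem hC (chart_source_mem_nhds (EuclideanSpace ℝ (Fin d)) x))
  filter_upwards [eventually_riemannianEDist_lt (𝓡 d) x c_pos] with y hy
  -- The distance need not be attained by a path, so the bound is proved for every `ρ` slightly
  -- larger than it, and then `ρ` tends to the distance.
  suffices H : ∀ ρ, riemannianEDist (𝓡 d) x y < ρ → ρ ≤ c →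
      ‖l (extChartAt (𝓡 d) x y - extChartAt (𝓡 d) x x)‖ₑ ≤ C * ρ by
    have A : ∀ᶠ ρ in 𝓝[>] (riemannianEDist (𝓡 d) x y),
        ‖l (extChartAt (𝓡 d) x y - extChartAt (𝓡 d) x x)‖ₑ ≤ C * ρ := by
      filter_upwards [Ioo_mem_nhdsGT hy] with ρ hρ using H ρ hρ.1 hρ.2.le
    have : (𝓝[>] (riemannianEDist (𝓡 d) x y)).NeBot := nhdsGT_neBot_of_exists_gt ⟨c, hy⟩
    refine ge_of_tendsto ?_ A
    exact (ENNReal.Tendsto.const_mul tendsto_id (Or.inr ENNReal.coe_ne_top)).mono_left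
      nhdsWithin_le_nhds
  intro ρ hρ hρc
  obtain ⟨γ, hγx, hγy, γ_smooth, hγ, -⟩ :=
    exists_lt_locally_constant_of_riemannianEDist_lt hρ zero_lt_one
  have mem : ∀ t ∈ Icc (0 : ℝ) 1, γ t ∈ {y | ∀ w : TangentSpace (𝓡 d) y,
      ‖l (mfderiv (𝓡 d) 𝓘(ℝ, EuclideanSpace ℝ (Fin d)) (extChartAt (𝓡 d) x) y w)‖ₑ
        ≤ C * ‖w‖ₑ} ∩ (chartAt (EuclideanSpace ℝ (Fin d)) x).source := by
    intro t ht
    apply hc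
    have h1 : riemannianEDist (𝓡 d) x (γ t) ≤ pathELength (𝓡 d) γ 0 t :=
      riemannianEDist_le_pathELength γ_smooth.contMDiffOn hγx rfl ht.1
    exact (h1.trans (pathELength_mono le_rfl ht.2)).trans_lt (hγ.trans_le hρc)
  let γ' := (extChartAt (𝓡 d) x) ∘ γ
  have hγ' : ContMDiffOn 𝓘(ℝ, ℝ) 𝓘(ℝ, EuclideanSpace ℝ (Fin d)) 1 γ' (Icc 0 1) :=
    contMDiffOn_extChartAt.comp (I' := 𝓡 d) (t := (chartAt (EuclideanSpace ℝ (Fin d)) x).source)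
      γ_smooth.contMDiffOn (fun t ht ↦ (mem t ht).2)
  rw [contMDiffOn_iff_contDiffOn] at hγ'
  have e : l (extChartAt (𝓡 d) x y - extChartAt (𝓡 d) x x) = (l ∘ γ') 1 - (l ∘ γ') 0 := by
    simp [γ', hγx, hγy]
  rw [e]
  calc _ ≤ ∫⁻ t in Icc 0 1, ‖derivWithin (l ∘ γ') (Icc 0 1) t‖ₑ :=
        enorm_sub_le_lintegral_derivWithin_Icc_of_contDiffOn_Icc
          (l.contDiff.comp_contDiffOn hγ') zero_le_one
    _ ≤ ∫⁻ t in Icc 0 1, C * ‖mfderivWithin 𝓘(ℝ, ℝ) (𝓡 d) γ (Icc 0 1) t 1‖ₑ := by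
        apply setLIntegral_mono' measurableSet_Icc (fun t ht ↦ ?_)
        have u : UniqueDiffWithinAt ℝ (Icc (0 : ℝ) 1) t := uniqueDiffOn_Icc zero_lt_one t ht
        have h1 : mfderivWithin 𝓘(ℝ, ℝ) 𝓘(ℝ, EuclideanSpace ℝ (Fin d)) γ' (Icc 0 1) t =
            (mfderiv (𝓡 d) 𝓘(ℝ, EuclideanSpace ℝ (Fin d)) (extChartAt (𝓡 d) x) (γ t)) ∘L
              (mfderivWithin 𝓘(ℝ, ℝ) (𝓡 d) γ (Icc 0 1) t) := by
          apply mfderiv_comp_mfderivWithin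
          · exact mdifferentiableAt_extChartAt (mem t ht).2
          · exact (γ_smooth.mdifferentiable one_ne_zero).mdifferentiableOn _ ht
          · exact u.uniqueMDiffWithinAt
        have h2 : derivWithin (l ∘ γ') (Icc 0 1) t = l (derivWithin γ' (Icc 0 1) t) :=
          (l.hasFDerivAt.comp_hasDerivWithinAt t
            ((hγ'.differentiableOn one_ne_zero) t ht).hasDerivWithinAt).derivWithin u
        have h3 : derivWithin γ' (Icc 0 1) t =
            mfderivWithin 𝓘(ℝ, ℝ) 𝓘(ℝ, EuclideanSpace ℝ (Fin d)) γ' (Icc 0 1) t 1 := by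
          rw [mfderivWithin_eq_fderivWithin, ← fderivWithin_derivWithin]; rfl
        rw [h2, h3, h1]
        exact (mem t ht).1 _
    _ = C * pathELength (𝓡 d) γ 0 1 := by
        rw [lintegral_const_mul' _ _ ENNReal.coe_ne_top, pathELength_eq_lintegral_mfderivWithin_Icc]
    _ ≤ C * ρ := by gcongr

end LocalDistance

/-! ### The distance determines the metric -/

namespace C2Metric

variable {d : ℕ} {M : Type*} [TopologicalSpace M]
  [ChartedSpace (EuclideanSpace ℝ (Fin d)) M] [IsManifold (𝓡 d) ∞ M]

lemma inner_self_nonneg (g : C2Metric d M) (x : M) (v : TangentSpace (𝓡 d) x) :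
    0 ≤ g.inner x v v := by
  rcases eq_or_ne v 0 with rfl | hv
  · simp
  · exact (g.pos x v hv).le

/-- The inner products of `g` vary continuously, in the typeclass form used by Mathlib's results on
Riemannian distances. -/
lemma isContinuousRiemannianBundle (g : C2Metric d M) :
    letI : Bundle.RiemannianBundle (fun x : M => TangentSpace (𝓡 d) x) := ⟨g.toRiemannianMetric⟩
    IsContinuousRiemannianBundle (EuclideanSpace ℝ (Fin d))
      (fun x : M => TangentSpace (𝓡 d) x) :=
  letI : Bundle.RiemannianBundle (fun x : M => TangentSpace (𝓡 d) x) := ⟨g.toRiemannianMetric⟩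
  ⟨⟨g.inner, g.contMDiff.continuous, fun _ _ _ ↦ rfl⟩⟩

/-- The coordinate function `g_x(v, ·)` in the chart at `x` is, to first order, `|v|_g`-Lipschitz
for the geodesic distance. -/
lemma eventually_inner_sub_le_geodesicEDist [RegularSpace M] (g : C2Metric d M) (x : M)
    (v : EuclideanSpace ℝ (Fin d)) {r : ℝ} (hr : 1 < r) :
    ∀ᶠ y in 𝓝 x, ENNReal.ofReal |g.inner x v (extChartAt (𝓡 d) x y - extChartAt (𝓡 d) x x :
        EuclideanSpace ℝ (Fin d))| ≤
      ENNReal.ofReal (r * √(g.inner x v v)) * g.geodesicEDist x y := by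
  let : Bundle.RiemannianBundle (fun x : M => TangentSpace (𝓡 d) x) := ⟨g.toRiemannianMetric⟩
  have := g.isContinuousRiemannianBundle
  have key := eventually_norm_symmL_trivializationAt_self_comp_lt (EuclideanSpace ℝ (Fin d))
    (fun x : M => TangentSpace (𝓡 d) x) x hr
  let v' : TangentSpace (𝓡 d) x := v
  have hnorm : ‖v'‖ = √(g.inner x v v) := norm_eq_sqrt_real_inner v'
  let l : EuclideanSpace ℝ (Fin d) →L[ℝ] ℝ := g.inner x v
  have := eventually_enorm_clm_sub_le_riemannianEDist x l (Real.toNNReal (r * √(g.inner x v v))) ?_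
  · filter_upwards [this] with y hy
    rw [← Real.enorm_eq_ofReal_abs]
    exact hy
  · filter_upwards [key, chart_source_mem_nhds (EuclideanSpace ℝ (Fin d)) x] with y hy hys w
    rw [Real.enorm_eq_ofReal_abs]
    have h0 := TangentBundle.continuousLinearMapAt_trivializationAt (I := 𝓡 d) hys
    have h1 := TangentBundle.symmL_trivializationAt (I := 𝓡 d) (mem_chart_source _ x)
    have h2 := mfderivWithin_range_extChartAt_symm (I := 𝓡 d) (x := x)
    -- The tangent space at `x` is identified with the model space through the chart at `x` itself,
    -- so the trivialization at `x` is the identity on that fibre.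
    have h3 : ∀ z : EuclideanSpace ℝ (Fin d), (Bundle.Trivialization.symmL ℝ
        (trivializationAt (EuclideanSpace ℝ (Fin d)) (TangentSpace (𝓡 d)) x) x) z = z := by
      intro z
      rw [h1]
      exact congrArg (fun (T : EuclideanSpace ℝ (Fin d) →L[ℝ] EuclideanSpace ℝ (Fin d)) => T z) h2
    have h4 : |(inner ℝ v' ((Bundle.Trivialization.symmL ℝ
        (trivializationAt (EuclideanSpace ℝ (Fin d)) (TangentSpace (𝓡 d)) x) x ∘L
        Bundle.Trivialization.continuousLinearMapAt ℝ
        (trivializationAt (EuclideanSpace ℝ (Fin d)) (TangentSpace (𝓡 d)) x) y) w) : ℝ)|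
        ≤ ‖v'‖ * (r * ‖w‖) := by
      refine (abs_real_inner_le_norm _ _).trans ?_
      gcongr
      exact (ContinuousLinearMap.le_opNorm _ _).trans (by gcongr)
    rw [ContinuousLinearMap.comp_apply, h3, h0] at h4
    have h5 : |l (mfderiv (𝓡 d) 𝓘(ℝ, EuclideanSpace ℝ (Fin d)) (extChartAt (𝓡 d) x) y w)|
      ≤ ‖v'‖ * (r * ‖w‖) := h4
    refine (ENNReal.ofReal_le_ofReal h5).trans ?_
    rw [← mul_assoc, mul_comm ‖v'‖ r, hnorm, ENNReal.ofReal_mul (by positivity), ofReal_norm]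
    rfl

/-- To first order, the geodesic distance from `x` to the point with coordinates `φ x + s v` is at
most `s |v|_g`. -/
lemma eventually_geodesicEDist_le (g : C2Metric d M) (x : M)
    (v : EuclideanSpace ℝ (Fin d)) {r : ℝ} (hr : 1 < r) :
    ∀ᶠ s : ℝ in 𝓝[>] 0, g.geodesicEDist x
      ((extChartAt (𝓡 d) x).symm (extChartAt (𝓡 d) x x + s • v))
        ≤ ENNReal.ofReal s * ENNReal.ofReal (r * √(g.inner x v v)) := by
  let : Bundle.RiemannianBundle (fun x : M => TangentSpace (𝓡 d) x) := ⟨g.toRiemannianMetric⟩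
  have := g.isContinuousRiemannianBundle
  have key := eventually_norm_symmL_trivializationAt_comp_self_lt (EuclideanSpace ℝ (Fin d))
    (fun x : M => TangentSpace (𝓡 d) x) x hr
  let v' : TangentSpace (𝓡 d) x := v
  have hnorm : ‖v'‖ = √(g.inner x v v) := norm_eq_sqrt_real_inner v'
  refine eventually_riemannianEDist_le_mul x v (Real.toNNReal (r * √(g.inner x v v))) ?_
  have hT : (extChartAt (𝓡 d) x).target ∈ 𝓝 (extChartAt (𝓡 d) x x) :=
    extChartAt_target_mem_nhds x
  have hc : Tendsto (extChartAt (𝓡 d) x).symm (𝓝 (extChartAt (𝓡 d) x x)) (𝓝 x) := by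
    have := (continuousAt_extChartAt_symm (I := 𝓡 d) x).tendsto
    rwa [extChartAt_to_inv] at this
  filter_upwards [hT, hc key, hc (chart_source_mem_nhds (EuclideanSpace ℝ (Fin d)) x)]
    with u hu hy hys
  have h0 := TangentBundle.continuousLinearMapAt_trivializationAt (I := 𝓡 d) (mem_chart_source _ x)
  have h1 := TangentBundle.symmL_trivializationAt (I := 𝓡 d) hys
  have h2 := mfderiv_extChartAt_self (I := 𝓡 d) (x := x)
  have h3 : (Bundle.Trivialization.continuousLinearMapAt ℝ
      (trivializationAt (EuclideanSpace ℝ (Fin d)) (TangentSpace (𝓡 d)) x) x) v' = v' := by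
    rw [h0]
    exact congrArg (fun (T : EuclideanSpace ℝ (Fin d) →L[ℝ] EuclideanSpace ℝ (Fin d)) => T v) h2
  rw [(extChartAt (𝓡 d) x).right_inv hu] at h1
  have h4 := (ContinuousLinearMap.le_opNorm _ v').trans
    (mul_le_mul_of_nonneg_right hy.le (norm_nonneg v'))
  rw [ContinuousLinearMap.comp_apply, h3, h1, hnorm] at h4
  rw [← ofReal_norm]
  exact ENNReal.ofReal_le_ofReal h4

/-- Following the point with coordinates `φ x + s v` as `s → 0⁺`, the lower bound for the first
distance and the upper bound for the second one give `|v|₁² ≤ |v|₁ |v|₂`. -/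
lemma inner_self_le_of_geodesicEDist_eq [RegularSpace M] (g₁ g₂ : C2Metric d M) (x : M)
    (h : ∀ᶠ y in 𝓝 x, g₁.geodesicEDist x y = g₂.geodesicEDist x y)
    (v : EuclideanSpace ℝ (Fin d)) : g₁.inner x v v ≤ g₂.inner x v v := by
  have key : ∀ r : ℝ, 1 < r → g₁.inner x v v ≤
      r * √(g₁.inner x v v) * (r * √(g₂.inner x v v)) := by
    intro r hr
    have hc : Tendsto (fun s : ℝ => (extChartAt (𝓡 d) x).symm
        (extChartAt (𝓡 d) x x + s • v)) (𝓝[>] 0) (𝓝 x) := by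
      have h1 : Continuous (fun s : ℝ => extChartAt (𝓡 d) x x
        + s • v) := by fun_prop
      have h2 := (continuousAt_extChartAt_symm (I := 𝓡 d) x).tendsto
      rw [extChartAt_to_inv] at h2
      refine (h2.comp ?_).mono_left nhdsWithin_le_nhds
      simpa using h1.tendsto 0
    have hc' : Tendsto (fun s : ℝ => extChartAt (𝓡 d) x x
        + s • v) (𝓝[>] 0) (𝓝 (extChartAt (𝓡 d) x x)) := by
      have h1 : Continuous (fun s : ℝ => extChartAt (𝓡 d) x x
        + s • v) := by fun_prop
      refine Tendsto.mono_left ?_ nhdsWithin_le_nhds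
      simpa using h1.tendsto 0
    obtain ⟨s, h1, h2, h3, h4, s_pos⟩ :=
      ((hc.eventually (g₁.eventually_inner_sub_le_geodesicEDist x v hr)).and
      ((g₂.eventually_geodesicEDist_le x v hr).and ((hc.eventually h).and
      ((hc'.eventually (extChartAt_target_mem_nhds (I := 𝓡 d) x)).and
        self_mem_nhdsWithin)))).exists
    have s_pos : 0 < s := s_pos
    rw [h3, (extChartAt (𝓡 d) x).right_inv h4, add_sub_cancel_left] at h1
    have h5 : g₁.inner x v (s • v) = s * g₁.inner x v v :=
      (g₁.inner x v).map_smul s v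
    have h6 : ENNReal.ofReal (s * g₁.inner x v v) ≤ ENNReal.ofReal (r * √(g₁.inner x v v)) *
        (ENNReal.ofReal s * ENNReal.ofReal (r * √(g₂.inner x v v))) := by
      refine le_trans ?_ (h1.trans (mul_le_mul_right h2 _))
      rw [← h5]
      exact ENNReal.ofReal_le_ofReal (le_abs_self _)
    rw [← ENNReal.ofReal_mul s_pos.le, ← ENNReal.ofReal_mul (by positivity),
      ENNReal.ofReal_le_ofReal_iff (by positivity)] at h6
    have h7 : s * g₁.inner x v v ≤ s * (r * √(g₁.inner x v v) * (r * √(g₂.inner x v v))) := by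
      linarith
    exact le_of_mul_le_mul_left h7 s_pos
  have lim : Tendsto (fun r : ℝ => r * √(g₁.inner x v v) * (r * √(g₂.inner x v v))) (𝓝[>] 1)
      (𝓝 (√(g₁.inner x v v) * √(g₂.inner x v v))) := by
    have : Continuous (fun r : ℝ => r * √(g₁.inner x v v) * (r * √(g₂.inner x v v))) := by fun_prop
    simpa using (this.tendsto 1).mono_left nhdsWithin_le_nhds
  have h1 := ge_of_tendsto lim (by filter_upwards [self_mem_nhdsWithin] with r hr using key r hr)
  have a := g₁.inner_self_nonneg x v
  have b := g₂.inner_self_nonneg x v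
  have h2 := Real.sq_sqrt a
  by_contra hlt
  push Not at hlt
  have h3 := Real.sqrt_lt_sqrt b hlt
  nlinarith [Real.sqrt_nonneg (g₂.inner x v v)]

/-- A Riemannian metric is determined at `x` by the distances from `x` to nearby points. -/
theorem inner_eq_of_geodesicEDist_eq [RegularSpace M] (g₁ g₂ : C2Metric d M) (x : M)
    (h : ∀ᶠ y in 𝓝 x, g₁.geodesicEDist x y = g₂.geodesicEDist x y) :
    g₁.inner x = g₂.inner x := by
  have q : ∀ v : TangentSpace (𝓡 d) x, g₁.inner x v v = g₂.inner x v v := fun v =>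
    le_antisymm (inner_self_le_of_geodesicEDist_eq g₁ g₂ x h v)
      (inner_self_le_of_geodesicEDist_eq g₂ g₁ x (h.mono fun _ => Eq.symm) v)
  ext v w
  have h1 := q (v + w)
  -- Polarization.
  simp only [map_add, add_apply, q v, q w, g₁.symm x w v, g₂.symm x w v] at h1
  linarith

lemma ext_inner {g₁ g₂ : C2Metric d M} (h : ∀ x, g₁.inner x = g₂.inner x) : g₁ = g₂ := by
  cases g₁; cases g₂
  congr
  exact funext h

end C2Metric

/-! ### The Riemannian density in coordinates -/

namespace C2Metric

variable {d : ℕ} {M : Type*} [TopologicalSpace M]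
  [ChartedSpace (EuclideanSpace ℝ (Fin d)) M] [IsManifold (𝓡 d) ∞ M]

/-- Coordinate vector fields are continuous sections of the tangent bundle. -/
lemma continuousOn_mfderiv_chart_symm_apply (x : M) (v : EuclideanSpace ℝ (Fin d)) :
    ContinuousOn (fun u => (⟨(chartAt (EuclideanSpace ℝ (Fin d)) x).symm u,
      mfderiv (𝓡 d) (𝓡 d) (chartAt (EuclideanSpace ℝ (Fin d)) x).symm u v⟩ :
        TangentBundle (𝓡 d) M)) (chartAt (EuclideanSpace ℝ (Fin d)) x).target := by
  have hop : IsOpen (chartAt (EuclideanSpace ℝ (Fin d)) x).target :=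
    (chartAt (EuclideanSpace ℝ (Fin d)) x).open_target
  have h1 : ContMDiffOn (𝓡 d) (𝓡 d) 1 (chartAt (EuclideanSpace ℝ (Fin d)) x).symm
      (chartAt (EuclideanSpace ℝ (Fin d)) x).target := contMDiffOn_chart_symm
  have h2 := h1.continuousOn_tangentMapWithin le_rfl hop.uniqueMDiffOn
  have h3 : Continuous (fun u : EuclideanSpace ℝ (Fin d) =>
      (⟨u, v⟩ : TangentBundle (𝓡 d) (EuclideanSpace ℝ (Fin d)))) :=
    (tangentBundleModelSpaceHomeomorph (𝓡 d)).symm.continuous.comp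
      (Continuous.prodMk continuous_id continuous_const :
        Continuous (fun u : EuclideanSpace ℝ (Fin d) => (u, v)))
  refine (h2.comp h3.continuousOn (fun u hu => hu)).congr fun u hu => ?_
  simp only [Function.comp_apply, tangentMapWithin]
  rw [mfderivWithin_of_mem_nhds (hop.mem_nhds hu)]

lemma continuousOn_coordMatrix (g : C2Metric d M) (x : M) :
    ContinuousOn (g.coordMatrix x) (chartAt (EuclideanSpace ℝ (Fin d)) x).target := by
  let : Bundle.RiemannianBundle (fun x : M => TangentSpace (𝓡 d) x) := ⟨g.toRiemannianMetric⟩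
  have := g.isContinuousRiemannianBundle
  refine continuousOn_pi.2 fun i => continuousOn_pi.2 fun j => ?_
  exact ContinuousOn.inner_bundle (continuousOn_mfderiv_chart_symm_apply x _)
    (continuousOn_mfderiv_chart_symm_apply x _)

lemma coordMatrix_det_pos (g : C2Metric d M) (x : M) {u : EuclideanSpace ℝ (Fin d)}
    (hu : u ∈ (chartAt (EuclideanSpace ℝ (Fin d)) x).target) : 0 < (g.coordMatrix x u).det := by
  let : Bundle.RiemannianBundle (fun x : M => TangentSpace (𝓡 d) x) := ⟨g.toRiemannianMetric⟩
  let A : EuclideanSpace ℝ (Fin d) →ₗ[ℝ]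
    TangentSpace (𝓡 d) ((chartAt (EuclideanSpace ℝ (Fin d)) x).symm u) :=
    (mfderiv (𝓡 d) (𝓡 d) (chartAt (EuclideanSpace ℝ (Fin d)) x).symm u).toLinearMap
  have hA : Function.Injective A :=
    (mdifferentiable_chart (I := 𝓡 d) x).symm.mfderiv_injective hu
  have hli : LinearIndependent ℝ (A ∘ (EuclideanSpace.basisFun (Fin d) ℝ).toBasis) :=
    (EuclideanSpace.basisFun (Fin d) ℝ).toBasis.linearIndependent.map' A (LinearMap.ker_eq_bot.2 hA)
  have hgram : g.coordMatrix x u =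
      Matrix.gram ℝ (A ∘ (EuclideanSpace.basisFun (Fin d) ℝ).toBasis) := by
    ext i j
    simp [Matrix.gram, A, coordMatrix]
    rfl
  rw [hgram]
  exact (Matrix.posDef_gram_of_linearIndependent hli).det_pos

/-- The Riemannian density `√(det (g_{ij}))` in the coordinates of the chart at `x`. -/
noncomputable def chartDensity (g : C2Metric d M) (x : M) (u : EuclideanSpace ℝ (Fin d)) : ℝ :=
  √(g.coordMatrix x u).det

lemma continuousOn_chartDensity (g : C2Metric d M) (x : M) :
    ContinuousOn (g.chartDensity x) (chartAt (EuclideanSpace ℝ (Fin d)) x).target :=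
  ((continuous_id.matrix_det).comp_continuousOn (g.continuousOn_coordMatrix x)).sqrt

lemma chartDensity_pos (g : C2Metric d M) (x : M) {u : EuclideanSpace ℝ (Fin d)}
    (hu : u ∈ (chartAt (EuclideanSpace ℝ (Fin d)) x).target) : 0 < g.chartDensity x u :=
  Real.sqrt_pos.2 (g.coordMatrix_det_pos x hu)

lemma differentiableAt_chart_comp_symm (x x' : M) {u : EuclideanSpace ℝ (Fin d)}
    (hu : u ∈ (chartAt (EuclideanSpace ℝ (Fin d)) x).target)
    (hu' : (chartAt (EuclideanSpace ℝ (Fin d)) x).symm u ∈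
      (chartAt (EuclideanSpace ℝ (Fin d)) x').source) :
    DifferentiableAt ℝ (chartAt (EuclideanSpace ℝ (Fin d)) x' ∘
      (chartAt (EuclideanSpace ℝ (Fin d)) x).symm) u := by
  rw [← mdifferentiableAt_iff_differentiableAt]
  exact (mdifferentiableAt_atlas (I := 𝓡 d) (chart_mem_atlas _ x') hu').comp u
    (mdifferentiableAt_atlas_symm (I := 𝓡 d) (chart_mem_atlas _ x) hu)

/-- Under a change of charts the Riemannian density is multiplied by the absolute value of the
Jacobian, since the matrix of `g` becomes `Jᵀ G J`. -/
lemma chartDensity_eq_abs_det_mul (g : C2Metric d M) (x x' : M) {u : EuclideanSpace ℝ (Fin d)}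
    (hu : u ∈ (chartAt (EuclideanSpace ℝ (Fin d)) x).target)
    (hu' : (chartAt (EuclideanSpace ℝ (Fin d)) x).symm u ∈
      (chartAt (EuclideanSpace ℝ (Fin d)) x').source) :
    g.chartDensity x u = |(fderiv ℝ (chartAt (EuclideanSpace ℝ (Fin d)) x' ∘
      (chartAt (EuclideanSpace ℝ (Fin d)) x).symm) u).det| *
      g.chartDensity x' (chartAt (EuclideanSpace ℝ (Fin d)) x'
        ((chartAt (EuclideanSpace ℝ (Fin d)) x).symm u)) := by
  set φ := chartAt (EuclideanSpace ℝ (Fin d)) x with hφ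
  set φ' := chartAt (EuclideanSpace ℝ (Fin d)) x' with hφ'
  set J := fderiv ℝ (φ' ∘ φ.symm) u with hJ
  have hT := differentiableAt_chart_comp_symm x x' hu hu'
  let b := (EuclideanSpace.basisFun (Fin d) ℝ).toBasis
  have hder : mfderiv (𝓡 d) (𝓡 d) φ.symm u =
      (mfderiv (𝓡 d) (𝓡 d) φ'.symm (φ' (φ.symm u))).comp J := by
    have h1 : φ.symm =ᶠ[𝓝 u] φ'.symm ∘ (φ' ∘ φ.symm) := by
      filter_upwards [(φ.continuousAt_symm hu).preimage_mem_nhds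
        (φ'.open_source.mem_nhds hu')] with w hw
      exact (φ'.left_inv hw).symm
    rw [h1.mfderiv_eq, mfderiv_comp (I' := 𝓡 d) u
      (mdifferentiableAt_atlas_symm (chart_mem_atlas _ x') (φ'.map_source hu'))
      hT.mdifferentiableAt, mfderiv_eq_fderiv]
    rfl
  let A' : EuclideanSpace ℝ (Fin d) →L[ℝ] EuclideanSpace ℝ (Fin d) :=
    mfderiv (𝓡 d) (𝓡 d) φ'.symm (φ' (φ.symm u))
  let G : EuclideanSpace ℝ (Fin d) →L[ℝ] EuclideanSpace ℝ (Fin d) →L[ℝ] ℝ := g.inner (φ.symm u)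
  let B : LinearMap.BilinForm ℝ (EuclideanSpace ℝ (Fin d)) :=
    LinearMap.mk₂ ℝ (fun v w => G (A' v) (A' w)) (by simp) (by simp) (by simp) (by simp)
  have e1 : g.coordMatrix x' (φ' (φ.symm u)) = LinearMap.BilinForm.toMatrix b B := by
    ext i j
    rw [LinearMap.BilinForm.toMatrix_apply]
    simp only [coordMatrix, Matrix.of_apply]
    rw [φ'.left_inv hu']
    simp [B, b, G, A']
    rfl
  have e2 : g.coordMatrix x u = LinearMap.BilinForm.toMatrix b
      (B.comp J.toLinearMap J.toLinearMap) := by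
    ext i j
    rw [LinearMap.BilinForm.toMatrix_apply]
    simp only [coordMatrix, Matrix.of_apply]
    rw [hder]
    simp [B, b, G, A']
    rfl
  rw [chartDensity, chartDensity, e1, e2, LinearMap.BilinForm.toMatrix_comp b b, Matrix.det_mul,
    Matrix.det_mul, Matrix.det_transpose, LinearMap.det_toMatrix, mul_right_comm, ← sq,
    Real.sqrt_mul (sq_nonneg _), Real.sqrt_sq_eq_abs]

end C2Metric

/-! ### The Riemannian volume in a chart -/

namespace C2Metric

variable {d : ℕ} {M : Type*} [TopologicalSpace M]
  [ChartedSpace (EuclideanSpace ℝ (Fin d)) M] [MeasurableSpace M] [BorelSpace M]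

lemma aemeasurable_chart_symm (x : M) :
    AEMeasurable (chartAt (EuclideanSpace ℝ (Fin d)) x).symm
      (volume.restrict (chartAt (EuclideanSpace ℝ (Fin d)) x).target) :=
  (chartAt (EuclideanSpace ℝ (Fin d)) x).continuousOn_symm.aemeasurable
    (chartAt (EuclideanSpace ℝ (Fin d)) x).open_target.measurableSet

/-- The coordinates of a measurable set form a measurable set, although the inverse chart takes
arbitrary values outside the target of the chart. -/
lemma measurableSet_chart_symm_preimage (x : M) {s : Set M} (hs : MeasurableSet s) :
    MeasurableSet ((chartAt (EuclideanSpace ℝ (Fin d)) x).symm ⁻¹' s ∩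
      (chartAt (EuclideanSpace ℝ (Fin d)) x).target) := by
  classical
  have hT := (chartAt (EuclideanSpace ℝ (Fin d)) x).open_target.measurableSet
  have h := (chartAt (EuclideanSpace ℝ (Fin d)) x).continuousOn_symm.measurable_piecewise
    (continuousOn_const (c := x)) hT
  convert (h hs).inter hT using 1
  ext u
  by_cases hu : u ∈ (chartAt (EuclideanSpace ℝ (Fin d)) x).target <;> simp [hu]

variable [IsManifold (𝓡 d) ∞ M]

lemma chartVolume_apply (g : C2Metric d M) (x : M) {s : Set M} (hs : MeasurableSet s) :
    g.chartVolume x s = ∫⁻ u in (chartAt (EuclideanSpace ℝ (Fin d)) x).symm ⁻¹' s ∩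
      (chartAt (EuclideanSpace ℝ (Fin d)) x).target, ENNReal.ofReal (g.chartDensity x u) := by
  rw [chartVolume, Measure.map_apply_of_aemeasurable
    ((aemeasurable_chart_symm x).mono_ac (withDensity_absolutelyContinuous _ _)) hs,
    withDensity_apply',
    Measure.restrict_restrict' (chartAt (EuclideanSpace ℝ (Fin d)) x).open_target.measurableSet]
  rfl

/-- The volumes of two charts agree on their overlap, by the change of variables formula. -/
lemma chartVolume_eq_of_subset (g : C2Metric d M) (x x' : M) {s : Set M} (hs : MeasurableSet s)
    (hx : s ⊆ (chartAt (EuclideanSpace ℝ (Fin d)) x).source)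
    (hx' : s ⊆ (chartAt (EuclideanSpace ℝ (Fin d)) x').source) :
    g.chartVolume x s = g.chartVolume x' s := by
  rw [chartVolume_apply g x hs, chartVolume_apply g x' hs]
  set φ := chartAt (EuclideanSpace ℝ (Fin d)) x with hφ
  set φ' := chartAt (EuclideanSpace ℝ (Fin d)) x' with hφ'
  set A := φ.symm ⁻¹' s ∩ φ.target with hA
  have him : φ'.symm ⁻¹' s ∩ φ'.target = (φ' ∘ φ.symm) '' A := by
    ext w
    constructor
    · rintro ⟨hw, hwT⟩
      refine ⟨φ (φ'.symm w), ⟨?_, φ.map_source (hx hw)⟩, ?_⟩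
      · simpa [φ.left_inv (hx hw)] using hw
      · simp [φ.left_inv (hx hw), φ'.right_inv hwT]
    · rintro ⟨u, ⟨hu, huT⟩, rfl⟩
      refine ⟨?_, φ'.map_source (hx' hu)⟩
      simpa [φ'.left_inv (hx' hu)] using hu
  have hinj : InjOn (φ' ∘ φ.symm) A := by
    rintro u ⟨hu, huT⟩ w ⟨hw, hwT⟩ h
    have h1 := φ'.injOn (hx' hu) (hx' hw) h
    exact φ.symm.injOn huT hwT h1
  rw [him, lintegral_image_eq_lintegral_abs_det_fderiv_mul volume
    (measurableSet_chart_symm_preimage x hs)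
    (fun u hu => (differentiableAt_chart_comp_symm x x' hu.2
      (hx' hu.1)).hasFDerivAt.hasFDerivWithinAt) hinj]
  refine setLIntegral_congr_fun (measurableSet_chart_symm_preimage x hs) fun u hu => ?_
  rw [chartDensity_eq_abs_det_mul g x x' hu.2 (hx' hu.1), ENNReal.ofReal_mul (abs_nonneg _)]
  rfl

lemma chartVolume_compl_source (g : C2Metric d M) (x : M) :
    g.chartVolume x (chartAt (EuclideanSpace ℝ (Fin d)) x).sourceᶜ = 0 := by
  rw [chartVolume_apply g x (chartAt _ x).open_source.measurableSet.compl]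
  convert setLIntegral_empty _
  ext u
  simp only [mem_inter_iff, mem_preimage, mem_compl_iff, mem_empty_iff_false, iff_false, not_and]
  exact fun h hu => h ((chartAt (EuclideanSpace ℝ (Fin d)) x).map_target hu)

lemma chartVolume_restrict_source (g : C2Metric d M) (x : M) :
    (g.chartVolume x).restrict (chartAt (EuclideanSpace ℝ (Fin d)) x).source = g.chartVolume x :=
  Measure.restrict_eq_self_of_ae_mem (g.chartVolume_compl_source x)

/-- The supremum defining the Riemannian volume is taken over an uncountable family, but on the
domain of a chart it is the volume of this chart. -/
lemma volumeMeasure_restrict_source (g : C2Metric d M) (x : M) :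
    g.volumeMeasure.restrict (chartAt (EuclideanSpace ℝ (Fin d)) x).source = g.chartVolume x := by
  set S := (chartAt (EuclideanSpace ℝ (Fin d)) x).source with hS
  have hSm : MeasurableSet S := (chartAt _ x).open_source.measurableSet
  have hself : (g.chartVolume x).restrict S = g.chartVolume x := g.chartVolume_restrict_source x
  apply le_antisymm
  -- An upper bound of all the chart volumes which is not too large on `S`: the volume of the chart
  -- at `x`, plus the largest measure outside `S`.
  · have hle : g.volumeMeasure ≤ g.chartVolume x + (⊤ : Measure M).restrict Sᶜ := by
      refine iSup_le fun x' => Measure.le_iff.2 fun s hs => ?_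
      have hS' : MeasurableSet (chartAt (EuclideanSpace ℝ (Fin d)) x').source :=
        (chartAt _ x').open_source.measurableSet
      have h0 : g.chartVolume x' (s ∩ S) ≤ g.chartVolume x s := by
        calc g.chartVolume x' (s ∩ S)
            = g.chartVolume x' (s ∩ S ∩ (chartAt (EuclideanSpace ℝ (Fin d)) x').source) := by
              rw [← Measure.restrict_apply (hs.inter hSm), chartVolume_restrict_source]
          _ = g.chartVolume x (s ∩ S ∩ (chartAt (EuclideanSpace ℝ (Fin d)) x').source) :=
              g.chartVolume_eq_of_subset x' x ((hs.inter hSm).inter hS') inter_subset_right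
                (inter_subset_left.trans inter_subset_right)
          _ ≤ g.chartVolume x s := measure_mono (inter_subset_left.trans inter_subset_left)
      rw [Measure.add_apply, Measure.restrict_apply hs, ← measure_inter_add_sdiff s hSm]
      exact add_le_add h0 ((le_top : g.chartVolume x' ≤ ⊤) _)
    refine (Measure.restrict_mono subset_rfl hle).trans ?_
    rw [Measure.restrict_add, Measure.restrict_restrict hSm, inter_compl_self,
      Measure.restrict_empty, add_zero, hself]
  · rw [← hself]
    exact Measure.restrict_mono subset_rfl (le_iSup g.chartVolume x)

lemma integral_volumeMeasure_eq (g : C2Metric d M) (x : M) {F : M → ℝ} (hF : Continuous F)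
    (hsupp : ∀ y ∉ (chartAt (EuclideanSpace ℝ (Fin d)) x).source, F y = 0) :
    ∫ y, F y ∂g.volumeMeasure = ∫ u in (chartAt (EuclideanSpace ℝ (Fin d)) x).target,
      g.chartDensity x u * F ((chartAt (EuclideanSpace ℝ (Fin d)) x).symm u) := by
  have hρ : AEMeasurable (fun u => ENNReal.ofReal (g.chartDensity x u))
      (volume.restrict (chartAt (EuclideanSpace ℝ (Fin d)) x).target) :=
    ((g.continuousOn_chartDensity x).aemeasurable
      (chartAt _ x).open_target.measurableSet).ennreal_ofReal
  rw [← setIntegral_eq_integral_of_forall_compl_eq_zero hsupp, volumeMeasure_restrict_source,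
    chartVolume, integral_map
      ((aemeasurable_chart_symm x).mono_ac (withDensity_absolutelyContinuous _ _))
      hF.aestronglyMeasurable]
  refine (integral_withDensity_eq_integral_toReal_smul₀ hρ (by simp) _).trans ?_
  simp [chartDensity, Real.sqrt_nonneg]

end C2Metric

/-! ### The Gaussian kernel and the graph Laplacian -/

namespace C2Metric

variable {d : ℕ} {M : Type*} [TopologicalSpace M]
  [ChartedSpace (EuclideanSpace ℝ (Fin d)) M] [IsManifold (𝓡 d) ∞ M]

lemma geodesicEDist_self (g : C2Metric d M) (x : M) : g.geodesicEDist x x = 0 := by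
  let : Bundle.RiemannianBundle (fun x : M => TangentSpace (𝓡 d) x) := ⟨g.toRiemannianMetric⟩
  exact riemannianEDist_self

lemma gaussianKernel_self (g : C2Metric d M) (t : ℝ) (x : M) : g.gaussianKernel t x x = 1 := by
  simp [gaussianKernel, geodesicEDist_self]

lemma geodesicEDist_eq_of_gaussianKernel_eq {g₁ g₂ : C2Metric d M} {t : ℝ} (ht : 0 < t) {x y : M}
    (h : g₁.gaussianKernel t x y = g₂.gaussianKernel t x y) :
    g₁.geodesicEDist x y = g₂.geodesicEDist x y := by
  unfold gaussianKernel at h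
  split_ifs at h with h1 h2 h2
  · rw [h1, h2]
  · exact absurd h.symm (Real.exp_ne_zero _)
  · exact absurd h (Real.exp_ne_zero _)
  · have h3 := Real.exp_injective h
    rw [div_left_inj' ht.ne', neg_inj, sq_eq_sq₀ ENNReal.toReal_nonneg ENNReal.toReal_nonneg] at h3
    exact (ENNReal.toReal_eq_toReal_iff' h1 h2).1 h3

lemma continuous_gaussianKernel [RegularSpace M] (g : C2Metric d M) (t : ℝ) (x : M) :
    Continuous (g.gaussianKernel t x) := by
  let : Bundle.RiemannianBundle (fun x : M => TangentSpace (𝓡 d) x) := ⟨g.toRiemannianMetric⟩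
  have := g.isContinuousRiemannianBundle
  let : PseudoEMetricSpace M := .ofRiemannianMetric (𝓡 d) M
  have hd : Continuous (fun y => g.geodesicEDist x y) :=
    (continuous_const.edist continuous_id : Continuous (fun y => edist x y))
  have htri : ∀ y z : M, g.geodesicEDist x y ≤ g.geodesicEDist x z + edist z y :=
    fun y z => edist_triangle x z y
  rw [continuous_iff_continuousAt]
  intro y
  by_cases hy : g.geodesicEDist x y = ⊤
  · -- the points at infinite distance from `x` form an open set
    have h1 : ∀ᶠ z in 𝓝 y, g.geodesicEDist x z = ⊤ := by
      filter_upwards [Metric.eball_mem_nhds y one_pos] with z hz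
      have h2 := htri y z
      rw [hy, top_le_iff, ENNReal.add_eq_top] at h2
      exact h2.resolve_right (ne_top_of_lt (Metric.mem_eball.1 hz))
    refine (continuousAt_const (y := (0 : ℝ))).congr ?_
    filter_upwards [h1] with z hz
    simp [gaussianKernel, hz]
  · have h1 : ∀ᶠ z in 𝓝 y, g.geodesicEDist x z ≠ ⊤ :=
      hd.continuousAt.eventually_ne hy
    have h2 : ContinuousAt (fun z => Real.exp (-(g.geodesicEDist x z).toReal ^ 2 / t)) y := by
      have := (ENNReal.continuousAt_toReal hy).comp hd.continuousAt
      exact (((this.pow 2).neg).div_const t).rexp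
    refine h2.congr ?_
    filter_upwards [h1] with z hz
    simp [gaussianKernel, hz]

end C2Metric

/-- A test function in the coordinates of a chart, extended by zero to the whole space. -/
lemma exists_continuousMap_chart {E M : Type*} [TopologicalSpace E] [TopologicalSpace M]
    [T2Space M] (φ : OpenPartialHomeomorph M E) {k : E → ℝ} (hk : Continuous k)
    (hc : HasCompactSupport k) (hs : tsupport k ⊆ φ.target) :
    ∃ f : C(M, ℝ), (∀ y ∉ φ.source, f y = 0) ∧ ∀ u ∈ φ.target, f (φ.symm u) = k u := by
  classical
  let f : M → ℝ := fun y => if y ∈ φ.source then k (φ y) else 0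
  have hK : IsCompact (φ.symm '' tsupport k) :=
    hc.isCompact.image_of_continuousOn (φ.continuousOn_symm.mono hs)
  have hsub : tsupport f ⊆ φ.symm '' tsupport k := by
    refine closure_minimal (fun y hy => ?_) hK.isClosed
    by_cases hys : y ∈ φ.source
    · refine ⟨φ y, subset_tsupport k ?_, φ.left_inv hys⟩
      simpa [f, hys] using hy
    · simp [f, hys] at hy
  have hf : Continuous f := by
    refine continuous_of_tsupport fun y hy => ?_
    obtain ⟨u, hu, rfl⟩ := hsub hy
    have hys := φ.map_target (hs hu)
    refine (hk.continuousAt.comp (φ.continuousAt hys)).congr ?_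
    filter_upwards [φ.open_source.mem_nhds hys] with z hz
    simp [f, hz]
  refine ⟨⟨f, hf⟩, fun y hy => by simp [f, hy], fun u hu => ?_⟩
  simp [f, φ.map_target hu, φ.right_inv hu]

namespace C2Metric

variable {d : ℕ} {M : Type*} [TopologicalSpace M] [RegularSpace M]
  [ChartedSpace (EuclideanSpace ℝ (Fin d)) M] [IsManifold (𝓡 d) ∞ M]
  [MeasurableSpace M] [BorelSpace M]

/-- For `f` vanishing at `x` and outside the domain of a chart, the operator is an integral in the
coordinates of this chart. -/
lemma graphLaplacian_eq_setIntegral (g : C2Metric d M) (t : ℝ) (p f : C(M, ℝ)) (x x₀ : M)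
    (hfx : f x = 0)
    (hf : ∀ y ∉ (chartAt (EuclideanSpace ℝ (Fin d)) x₀).source, f y = 0) :
    g.graphLaplacian t p f x = -(1 / t ^ ((d : ℝ) / 2 + 1) *
      ∫ u in (chartAt (EuclideanSpace ℝ (Fin d)) x₀).target,
        f ((chartAt (EuclideanSpace ℝ (Fin d)) x₀).symm u) *
        (g.chartDensity x₀ u * g.gaussianKernel t x
            ((chartAt (EuclideanSpace ℝ (Fin d)) x₀).symm u) *
          p ((chartAt (EuclideanSpace ℝ (Fin d)) x₀).symm u))) := by
  have hF : Continuous (fun y => g.gaussianKernel t x y * (f x - f y) * p y) := by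
    have := g.continuous_gaussianKernel t x
    fun_prop
  rw [graphLaplacian, integral_volumeMeasure_eq g x₀ hF
    (fun y hy => by simp [hfx, hf y hy]), ← mul_neg, ← integral_neg]
  congr 2
  ext u
  rw [hfx]
  ring

/-- In coordinates, the operator at `x` determines the kernel times the volume density. Testing with
functions supported in the chart and away from `x` gives the equality almost everywhere, and both
sides are continuous. The dimension has to be positive for `{x}` to be negligible. -/
lemma chartDensity_mul_gaussianKernel_eq [T2Space M] (hd : d ≠ 0) {t : ℝ} (ht : 0 < t)
    {p : C(M, ℝ)}
    (hp : ∀ x, 0 < p x) {g₁ g₂ : C2Metric d M}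
    (h : ∀ (f : C(M, ℝ)) (x : M), g₁.graphLaplacian t p f x = g₂.graphLaplacian t p f x)
    (x x₀ : M) {u : EuclideanSpace ℝ (Fin d)}
    (hu : u ∈ (chartAt (EuclideanSpace ℝ (Fin d)) x₀).target) :
    g₁.chartDensity x₀ u * g₁.gaussianKernel t x
        ((chartAt (EuclideanSpace ℝ (Fin d)) x₀).symm u) =
      g₂.chartDensity x₀ u * g₂.gaussianKernel t x
        ((chartAt (EuclideanSpace ℝ (Fin d)) x₀).symm u) := by
  have : NeZero d := ⟨hd⟩
  have : Nontrivial (EuclideanSpace ℝ (Fin d)) := inferInstance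
  set φ := chartAt (EuclideanSpace ℝ (Fin d)) x₀ with hφ
  let H : C2Metric d M → EuclideanSpace ℝ (Fin d) → ℝ := fun g u =>
    g.chartDensity x₀ u * g.gaussianKernel t x (φ.symm u) * p (φ.symm u)
  have hH : ∀ g, ContinuousOn (H g) φ.target := fun g =>
    ((g.continuousOn_chartDensity x₀).mul
      ((g.continuous_gaussianKernel t x).comp_continuousOn φ.continuousOn_symm)).mul
      (p.continuous.comp_continuousOn φ.continuousOn_symm)
  have hU : IsOpen (φ.target \ {φ x}) := φ.open_target.sdiff isClosed_singleton
  have hae : ∀ᵐ w, w ∈ φ.target \ {φ x} → H g₁ w - H g₂ w = 0 := by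
    refine hU.ae_eq_zero_of_integral_contDiff_smul_eq_zero
      ((((hH g₁).sub (hH g₂)).mono sdiff_subset).locallyIntegrableOn hU.measurableSet)
      fun k hk hkc hks => ?_
    obtain ⟨f, hf0, hf⟩ := exists_continuousMap_chart φ hk.continuous hkc (hks.trans sdiff_subset)
    have hfx : f x = 0 := by
      by_cases hx : x ∈ φ.source
      · rw [← φ.left_inv hx, hf _ (φ.map_source hx)]
        exact image_eq_zero_of_notMem_tsupport fun hmem => (hks hmem).2 rfl
      · exact hf0 x hx
    have hkU : ∀ w ∉ φ.target, k w = 0 := fun w hw =>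
      image_eq_zero_of_notMem_tsupport fun hmem => hw (hks hmem).1
    have hint : ∀ g, Integrable (fun w => k w * H g w) := by
      intro g
      rw [← integrableOn_iff_integrable_of_support_subset (s := tsupport k)]
      · exact (hk.continuous.continuousOn.mul
          ((hH g).mono (hks.trans sdiff_subset))).integrableOn_compact hkc.isCompact
      · exact (Function.support_mul_subset_left _ _).trans (subset_tsupport k)
    have hL : ∀ g : C2Metric d M, g.graphLaplacian t p f x =
        -(1 / t ^ ((d : ℝ) / 2 + 1) * ∫ w, k w * H g w) := by
      intro g
      rw [graphLaplacian_eq_setIntegral g t p f x x₀ hfx hf0,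
        ← setIntegral_eq_integral_of_forall_compl_eq_zero (f := fun w => k w * H g w)
          (s := φ.target) (fun w hw => by rw [hkU w hw, zero_mul])]
      congr 2
      refine setIntegral_congr_fun φ.open_target.measurableSet fun w hw => ?_
      simp only [← hφ, hf w hw, H]
    have e := h f x
    rw [hL, hL, neg_inj] at e
    have e' := mul_left_cancel₀ (by positivity) e
    simp only [smul_eq_mul, mul_sub]
    rw [integral_sub (hint g₁) (hint g₂), e', sub_self]
  have hae' : H g₁ =ᵐ[volume.restrict φ.target] H g₂ := by
    rw [EventuallyEq, ae_restrict_iff' φ.open_target.measurableSet]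
    filter_upwards [hae, compl_mem_ae_iff.2 (measure_singleton (μ := volume) (φ x))]
      with w hw hwx hwT
    exact sub_eq_zero.1 (hw ⟨hwT, hwx⟩)
  have := Measure.eqOn_open_of_ae_eq hae' φ.open_target (hH g₁) (hH g₂) hu
  exact mul_right_cancel₀ (hp _).ne' this

end C2Metric

end

theorem mainTheorem2 {d : ℕ} {M : Type*} [TopologicalSpace M] [T2Space M] [CompactSpace M]
    [ChartedSpace (EuclideanSpace ℝ (Fin d)) M] [IsManifold (𝓡 d) ∞ M]
    [MeasurableSpace M] [BorelSpace M]
    (t : ℝ) (ht : 0 < t) (p : C(M, ℝ)) (hp : ∀ x, 0 < p x)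
    (g₁ g₂ : C2Metric d M)
    (h : ∀ (f : C(M, ℝ)) (x : M), g₁.graphLaplacian t p f x = g₂.graphLaplacian t p f x) :
    g₁ = g₂ := by
  refine C2Metric.ext_inner fun x₀ => ?_
  rcases eq_or_ne d 0 with rfl | hd
  -- In dimension zero the tangent spaces are trivial.
  · have : Subsingleton (TangentSpace (𝓡 0) x₀) :=
      inferInstanceAs (Subsingleton (EuclideanSpace ℝ (Fin 0)))
    ext v w
    simp [Subsingleton.elim v 0]
  · have key := fun x u hu =>
      C2Metric.chartDensity_mul_gaussianKernel_eq hd ht hp h x x₀ (u := u) hu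
    refine C2Metric.inner_eq_of_geodesicEDist_eq g₁ g₂ x₀ ?_
    filter_upwards [chart_source_mem_nhds (EuclideanSpace ℝ (Fin d)) x₀] with y hy
    have hyT := (chartAt (EuclideanSpace ℝ (Fin d)) x₀).map_source hy
    have h1 := key y _ hyT
    have h2 := key x₀ _ hyT
    rw [(chartAt (EuclideanSpace ℝ (Fin d)) x₀).left_inv hy] at h1 h2
    -- At `x = y` both kernels are `1`, so the densities agree; they then cancel from the equality for
    -- the kernels at `x₀`.
    rw [C2Metric.gaussianKernel_self, C2Metric.gaussianKernel_self, mul_one, mul_one] at h1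
    rw [← h1] at h2
    exact C2Metric.geodesicEDist_eq_of_gaussianKernel_eq ht
      (mul_left_cancel₀ (g₁.chartDensity_pos x₀ hyT).ne' h2)
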